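/- Let $d$ be a natural number and, for $t>0$, let $e^{t\Delta/2}$ be the time-$t$ heat operator on $\mathbb{R}^d$, given on (complex-valued) $f\in L^2(\mathbb{R}^d,dx)$ by $$(e^{t\Delta/2}f)(x)=(2\pi t)^{-d/2}\int_{\mathbb{R}^d}e^{-|x-x'|^2/2t}f(x')\,dx',\qquad x\in\mathbb{R}^d.$$ Let $s,t>0$, let $f_1,f_2\in L^2(\mathbb{R}^d,dx)$, put $F_1=e^{t\Delta/2}f_1$ and $F_2=e^{s\Delta/2}f_2$, and let $r$ be the real number with $1/r=1/s+1/t$. Then there is a unique $f\in L^2(\mathbb{R}^d,dx)$ such that $F_1F_2=e^{r\Delta/2}f$. More precisely, the identity $F_1(x)F_2(x)=(e^{r\Delta/2}f)(x)$ holds at every $x\in\mathbb{R}^d$, and $f$ is the only element of $L^2(\mathbb{R}^d,dx)$ for which it holds at almost every $x$. Furthermore, if $f_1$ or $f_2$ is (almost everywhere equal to) a Schwartz function, then so is $f$. -/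

import Mathlib

open MeasureTheory

/-- The heat kernel `ρ_t(x) = (2πt)^{-d/2} e^{-|x|²/(2t)}` on `ℝ^d`. -/
noncomputable def heatKernel (d : ℕ) (t : ℝ) (x : EuclideanSpace ℝ (Fin d)) : ℝ :=
  (2 * Real.pi * t) ^ (-(d : ℝ) / 2) * Real.exp (-‖x‖ ^ 2 / (2 * t))

/-- The time-`t` forward heat operator `e^{tΔ/2}` on `ℝ^d` for `t > 0`, as convolution with the
heat kernel: `(e^{tΔ/2} f)(x) = ∫ ρ_t(x - x') f(x') dx'`. For `f` in `L²` the integral converges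
absolutely at every `x`, and it depends only on the almost-everywhere class of `f`. -/
noncomputable def heatOperator {d : ℕ} (t : ℝ) (f : EuclideanSpace ℝ (Fin d) → ℂ)
    (x : EuclideanSpace ℝ (Fin d)) : ℂ :=
  ∫ x' : EuclideanSpace ℝ (Fin d), (heatKernel d t (x - x') : ℂ) * f x'

/-- An element of `L²(ℝ^d)` lies in the Schwartz space: its class contains a Schwartz function. -/
def IsSchwartzClass {d : ℕ}
    (f : Lp ℂ 2 (volume : Measure (EuclideanSpace ℝ (Fin d)))) : Prop :=
  ∃ φ : SchwartzMap (EuclideanSpace ℝ (Fin d)) ℂ, ∀ᵐ x, f x = φ x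

/-!
The product `ρ_t(x - u) ρ_s(x - v)` of two heat kernels is again a product of heat kernels: with
`α = t/(s+t)`, `β = s/(s+t)`, writing `u = w + αz` and `v = w - βz`, completing the square gives
`ρ_t(x - u) ρ_s(x - v) = ρ_r(x - w) ρ_{s+t}(z)` (`heatKernel_mul_heatKernel`). Since
`(w, z) ↦ (u, v)` preserves Lebesgue measure, Fubini shows that `F₁ F₂ = e^{rΔ/2} f` holds
pointwise for `f(w) = ∫ ρ_{s+t}(z) f₁(w + αz) f₂(w - βz) dz` (`heatProduct`,
`heatOperator_mul_heatOperator`). Cauchy–Schwarz in `z` and the same change of variables give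
`‖f‖₂ ≤ ‖ρ_{s+t}‖₂ ‖f₁‖₂ ‖f₂‖₂` (`memLp_heatProduct`).

Uniqueness is injectivity of `e^{rΔ/2}` on `L²` (`eq_of_heatOperator_ae_eq`). If `e^{rΔ/2} h = 0`
almost everywhere, then so is its product with `ρ_r`, which by the kernel identity with `s = t = r`
is the convolution of a Gaussian with a dilate of `ρ_{2r} h ∈ L¹`. As the Fourier transform of the
Gaussian has no zeros, that of `ρ_{2r} h` vanishes, and hence so does `h`.

If `f₁` is Schwartz, the substitution `v = w - βz` writes `f` as `∫ K(w, v) f₂(v) dv` with `K` a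
Schwartz function on `ℝ^d × ℝ^d`, namely the tensor product of `ρ_{s+t}` and `f₁` composed with an
invertible linear map; such integral operators map `L²` into the Schwartz space
(`exists_schwartz_eq_integral_smul`). The case of `f₂` follows by exchanging the roles of the two
factors and using uniqueness.
-/

open scoped SchwartzMap ContDiff

/-! ### Gaussians as Schwartz functions -/

lemma one_add_pow_mul_exp_neg_mul_sq_le {a : ℝ} (ha : 0 < a) (N : ℕ) :
    ∃ C, ∀ x : ℝ, 0 ≤ x → (1 + x) ^ N * Real.exp (-a * x ^ 2) ≤ C := by
  refine ⟨2 ^ N * (N.factorial / a ^ N * Real.exp a), fun x hx => ?_⟩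
  have h1 : (1 + x) ^ N ≤ 2 ^ N * (1 + x ^ 2) ^ N := by
    rw [← mul_pow]
    exact pow_le_pow_left₀ (by positivity) (by nlinarith [sq_nonneg (x - 1)]) N
  have h2 := Real.pow_div_factorial_le_exp (a * (1 + x ^ 2)) (by positivity) N
  have hN : (0 : ℝ) < N.factorial := by positivity
  have h3 : (1 + x ^ 2) ^ N ≤ N.factorial / a ^ N * Real.exp (a * (1 + x ^ 2)) := by
    rw [mul_pow, div_le_iff₀ hN] at h2
    rw [div_mul_eq_mul_div, le_div_iff₀ (by positivity)]
    linarith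
  calc (1 + x) ^ N * Real.exp (-a * x ^ 2)
      ≤ 2 ^ N * (N.factorial / a ^ N * Real.exp (a * (1 + x ^ 2))) * Real.exp (-a * x ^ 2) := by
        gcongr
        exact h1.trans (by gcongr)
    _ = 2 ^ N * (N.factorial / a ^ N * Real.exp a) := by
        have : Real.exp (a * (1 + x ^ 2)) * Real.exp (-a * x ^ 2) = Real.exp a := by
          rw [← Real.exp_add]; congr 1; ring
        rw [← this]; ring

section Gaussian

variable {E : Type} [NormedAddCommGroup E] [InnerProductSpace ℝ E]

/-- Differentiating `exp (-a‖x‖²) • p x` gives a function of the same form, so the decay of all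
derivatives follows by induction on their order, over all coefficients `p` of temperate growth. -/
lemma exp_neg_mul_sq_smul_decay {a : ℝ} (ha : 0 < a) (k n : ℕ) :
    ∀ {V : Type} [NormedAddCommGroup V] [NormedSpace ℝ V] (p : E → V), p.HasTemperateGrowth →
      ∃ C, ∀ x, ‖x‖ ^ k *
        ‖iteratedFDeriv ℝ n (fun x : E => Real.exp (-a * ‖x‖ ^ 2) • p x) x‖ ≤ C := by
  induction n with
  | zero =>
    intro V _ _ p hp
    obtain ⟨m, C, h⟩ := hp.2 0
    obtain ⟨D, hD⟩ := one_add_pow_mul_exp_neg_mul_sq_le ha (k + m)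
    have hC : 0 ≤ C := by
      have := (norm_nonneg _).trans (h 0)
      simpa using this
    refine ⟨C * D, fun x => ?_⟩
    have h1 := h x
    rw [norm_iteratedFDeriv_zero] at h1 ⊢
    rw [norm_smul, Real.norm_of_nonneg (Real.exp_nonneg _)]
    calc ‖x‖ ^ k * (Real.exp (-a * ‖x‖ ^ 2) * ‖p x‖)
        ≤ (1 + ‖x‖) ^ k * (Real.exp (-a * ‖x‖ ^ 2) * (C * (1 + ‖x‖) ^ m)) := by
          gcongr
          linarith
      _ = C * ((1 + ‖x‖) ^ (k + m) * Real.exp (-a * ‖x‖ ^ 2)) := by ring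
      _ ≤ C * D := by gcongr; exact hD _ (norm_nonneg _)
  | succ n ih =>
    intro V _ _ p hp
    have hlin : (fun x : E => (ContinuousLinearMap.smulRightL ℝ E V (innerSL ℝ x)) (p x)
        ).HasTemperateGrowth :=
      ((ContinuousLinearMap.smulRightL ℝ E V).comp (innerSL ℝ)).bilinear_hasTemperateGrowth
        Function.HasTemperateGrowth.id' hp
    have hder : (fderiv ℝ p).HasTemperateGrowth := by
      refine ⟨(contDiff_infty_iff_fderiv.1 hp.1).2, fun m => ?_⟩
      obtain ⟨l, C, h⟩ := hp.2 (m + 1)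
      exact ⟨l, C, fun x => by simpa only [norm_iteratedFDeriv_fderiv] using h x⟩
    have hq := hder.add ((Function.HasTemperateGrowth.const (-(2 * a))).smul hlin)
    obtain ⟨C, hC⟩ := ih _ hq
    refine ⟨C, fun x => ?_⟩
    rw [← norm_iteratedFDeriv_fderiv]
    convert hC x using 4
    ext1 y
    have h1 : HasFDerivAt (fun x : E => Real.exp (-a * ‖x‖ ^ 2))
        (Real.exp (-a * ‖y‖ ^ 2) • ((-a) • (2 • innerSL ℝ y))) y :=
      (((hasStrictFDerivAt_norm_sq y).hasFDerivAt).const_mul (-a)).exp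
    have h2 := (h1.smul (hp.1.differentiable (by simp) y).hasFDerivAt).fderiv
    refine h2.trans ?_
    ext v
    simp [smul_smul]
    ring_nf

/-- The Gaussian `x ↦ exp (-a‖x‖²)` as a Schwartz function. -/
noncomputable def gaussianSchwartz (E : Type) [NormedAddCommGroup E] [InnerProductSpace ℝ E]
    (a : ℝ) (ha : 0 < a) : 𝓢(E, ℂ) where
  toFun x := (Real.exp (-a * ‖x‖ ^ 2) : ℂ)
  smooth' := by
    have : ContDiff ℝ ∞ fun x : E => Real.exp (-a * ‖x‖ ^ 2) :=
      (contDiff_const.mul (contDiff_norm_sq ℝ)).exp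
    exact Complex.ofRealCLM.contDiff.comp this
  decay' k n := by
    obtain ⟨C, hC⟩ := exp_neg_mul_sq_smul_decay (E := E) ha k n (fun _ : E => (1 : ℂ))
      (Function.HasTemperateGrowth.const 1)
    refine ⟨C, fun x => ?_⟩
    simpa only [Complex.real_smul, mul_one] using hC x

@[simp] lemma gaussianSchwartz_apply (a : ℝ) (ha : 0 < a) (x : E) :
    gaussianSchwartz E a ha x = (Real.exp (-a * ‖x‖ ^ 2) : ℂ) := rfl

end Gaussian

/-! ### Tensor products of Schwartz functions -/

section Tensor

variable {E F : Type} [NormedAddCommGroup E] [NormedSpace ℝ E]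
  [NormedAddCommGroup F] [NormedSpace ℝ F]

lemma norm_iteratedFDeriv_comp_le_of_norm_le_one {V : Type} [NormedAddCommGroup V]
    [NormedSpace ℝ V] {f : F → V} (hf : ContDiff ℝ ∞ f) (L : E →L[ℝ] F) (hL : ‖L‖ ≤ 1)
    (n : ℕ) (x : E) :
    ‖iteratedFDeriv ℝ n (fun x => f (L x)) x‖ ≤ ‖iteratedFDeriv ℝ n f (L x)‖ := by
  have := L.iteratedFDeriv_comp_right (f := f) (n := ∞) hf x (i := n) (by exact_mod_cast le_top)
  rw [show (fun x => f (L x)) = f ∘ L from rfl, this]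
  refine (ContinuousMultilinearMap.norm_compContinuousLinearMap_le _ _).trans ?_
  refine mul_le_of_le_one_right (norm_nonneg _) ?_
  exact Finset.prod_le_one (fun _ _ => norm_nonneg _) (fun _ _ => hL)

/-- The tensor product `(x, y) ↦ φ x * ψ y` of two Schwartz functions. -/
noncomputable def schwartzTensor (φ : 𝓢(E, ℂ)) (ψ : 𝓢(F, ℂ)) : 𝓢(E × F, ℂ) where
  toFun p := φ p.1 * ψ p.2
  smooth' := ((φ.smooth ⊤).comp contDiff_fst).mul ((ψ.smooth ⊤).comp contDiff_snd)
  decay' k n := by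
    have hφ : ContDiff ℝ ∞ fun p : E × F => φ p.1 := (φ.smooth ⊤).comp contDiff_fst
    have hψ : ContDiff ℝ ∞ fun p : E × F => ψ p.2 := (ψ.smooth ⊤).comp contDiff_snd
    let A (i j : ℕ) := SchwartzMap.seminorm ℝ i j φ
    let B (i j : ℕ) := SchwartzMap.seminorm ℝ i j ψ
    refine ⟨∑ i ∈ Finset.range (n + 1), (n.choose i : ℝ) *
      (A k i * B 0 (n - i) + A 0 i * B k (n - i)), fun p => ?_⟩
    have h1 := norm_iteratedFDeriv_mul_le (N := ∞) hφ hψ p (n := n) (by exact_mod_cast le_top)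
    refine (mul_le_mul_of_nonneg_left h1 (by positivity)).trans ?_
    rw [Finset.mul_sum]
    refine Finset.sum_le_sum fun i _ => ?_
    have ha := norm_iteratedFDeriv_comp_le_of_norm_le_one (φ.smooth ⊤)
      (ContinuousLinearMap.fst ℝ E F) (ContinuousLinearMap.norm_fst_le ℝ E F) i p
    have hb := norm_iteratedFDeriv_comp_le_of_norm_le_one (ψ.smooth ⊤)
      (ContinuousLinearMap.snd ℝ E F) (ContinuousLinearMap.norm_snd_le ℝ E F) (n - i) p
    simp only [ContinuousLinearMap.coe_fst', ContinuousLinearMap.coe_snd'] at ha hb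
    have hk : ‖p‖ ^ k ≤ ‖p.1‖ ^ k + ‖p.2‖ ^ k := by
      rw [Prod.norm_def]
      rcases max_choice ‖p.1‖ ‖p.2‖ with h | h <;> rw [h]
      · exact le_add_of_nonneg_right (by positivity)
      · exact le_add_of_nonneg_left (by positivity)
    have c1 := φ.le_seminorm ℝ k i p.1
    have c2 := φ.norm_iteratedFDeriv_le_seminorm ℝ i p.1
    have c3 := ψ.le_seminorm ℝ k (n - i) p.2
    have c4 := ψ.norm_iteratedFDeriv_le_seminorm ℝ (n - i) p.2
    calc ‖p‖ ^ k * ((n.choose i : ℝ) * ‖iteratedFDeriv ℝ i (fun p : E × F => φ p.1) p‖ *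
          ‖iteratedFDeriv ℝ (n - i) (fun p : E × F => ψ p.2) p‖)
        ≤ (‖p.1‖ ^ k + ‖p.2‖ ^ k) * ((n.choose i : ℝ) * ‖iteratedFDeriv ℝ i φ p.1‖ *
          ‖iteratedFDeriv ℝ (n - i) ψ p.2‖) := by gcongr
      _ = (n.choose i : ℝ) * ((‖p.1‖ ^ k * ‖iteratedFDeriv ℝ i φ p.1‖) *
            ‖iteratedFDeriv ℝ (n - i) ψ p.2‖ + ‖iteratedFDeriv ℝ i φ p.1‖ *
            (‖p.2‖ ^ k * ‖iteratedFDeriv ℝ (n - i) ψ p.2‖)) := by ring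
      _ ≤ (n.choose i : ℝ) * (A k i * B 0 (n - i) + A 0 i * B k (n - i)) := by
          gcongr

@[simp] lemma schwartzTensor_apply (φ : 𝓢(E, ℂ)) (ψ : 𝓢(F, ℂ)) (p : E × F) :
    schwartzTensor φ ψ p = φ p.1 * ψ p.2 := rfl

end Tensor

/-! ### Integral operators with Schwartz kernel -/

section Kernel

variable {E F : Type} [NormedAddCommGroup E] [NormedSpace ℝ E]
  [NormedAddCommGroup F] [NormedSpace ℝ F]

lemma SchwartzMap.exists_norm_pow_mul_one_add_norm_pow_mul_le {V : Type} [NormedAddCommGroup V]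
    [NormedSpace ℝ V] (K : 𝓢(E × F, V)) (k N : ℕ) :
    ∃ C, 0 ≤ C ∧ ∀ w v, ‖w‖ ^ k * ‖K (w, v)‖ ≤ C * ((1 + ‖v‖) ^ N)⁻¹ := by
  refine ⟨2 ^ (k + N) * (Finset.Iic (k + N, 0)).sup
    (fun m => SchwartzMap.seminorm ℝ m.1 m.2) K, by positivity, fun w v => ?_⟩
  have h := SchwartzMap.one_add_le_sup_seminorm_apply (𝕜 := ℝ) (m := (k + N, 0)) le_rfl le_rfl K
    (w, v)
  rw [norm_iteratedFDeriv_zero] at h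
  rw [← div_eq_mul_inv, le_div_iff₀ (by positivity)]
  refine le_trans ?_ h
  rw [pow_add, mul_right_comm]
  have hw : ‖w‖ ≤ 1 + ‖(w, v)‖ := by linarith [norm_fst_le (w, v)]
  have hv : ‖v‖ ≤ ‖(w, v)‖ := norm_snd_le (w, v)
  gcongr

/-- The derivative of a Schwartz function on a product in the first variable. -/
noncomputable def fderivFst {V : Type} [NormedAddCommGroup V]
    [NormedSpace ℝ V] (K : 𝓢(E × F, V)) : 𝓢(E × F, E →L[ℝ] V) :=
  SchwartzMap.postcompCLM (𝕜 := ℝ)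
    ((ContinuousLinearMap.compL ℝ E (E × F) V).flip (ContinuousLinearMap.inl ℝ E F))
    (SchwartzMap.fderivCLM ℝ (E × F) V K)

lemma hasFDerivAt_fderivFst {V : Type} [NormedAddCommGroup V]
    [NormedSpace ℝ V] (K : 𝓢(E × F, V)) (w : E) (v : F) :
    HasFDerivAt (fun w => K (w, v)) (fderivFst K (w, v)) w :=
  K.differentiableAt.hasFDerivAt.comp w (hasFDerivAt_prodMk_left w v)

variable [MeasurableSpace F] [BorelSpace F] [FiniteDimensional ℝ F]
  {μ : Measure F}

lemma integrable_smul_of_norm_le {V : Type} [NormedAddCommGroup V] [NormedSpace ℝ V]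
    [NormedSpace ℂ V] {g : F → ℂ} {N : ℕ}
    (hg : Integrable (fun v => ((1 + ‖v‖) ^ N)⁻¹ * ‖g v‖) μ)
    (hgm : AEStronglyMeasurable g μ) {K : F → V} (hK : Continuous K) {C : ℝ}
    (h : ∀ v, ‖K v‖ ≤ C * ((1 + ‖v‖) ^ N)⁻¹) :
    Integrable (fun v => g v • K v) μ := by
  refine (hg.const_mul C).mono' (hgm.smul hK.aestronglyMeasurable) (ae_of_all _ fun v => ?_)
  rw [norm_smul, mul_comm, ← mul_assoc]
  gcongr
  exact h v

/-- Derivatives of `w ↦ ∫ g v • K (w, v)` are obtained by differentiating the kernel, and the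
derivative of the kernel is again Schwartz; hence the induction over all target spaces `V`. -/
lemma integral_smul_schwartz_decay {g : F → ℂ} {N : ℕ}
    (hg : Integrable (fun v => ((1 + ‖v‖) ^ N)⁻¹ * ‖g v‖) μ)
    (hgm : AEStronglyMeasurable g μ) (n : ℕ) :
    ∀ {V : Type} [NormedAddCommGroup V] [NormedSpace ℝ V] [NormedSpace ℂ V]
      [SMulCommClass ℝ ℂ V] (K : 𝓢(E × F, V)),
      ContDiff ℝ n (fun w => ∫ v, g v • K (w, v) ∂μ) ∧ ∀ k : ℕ, ∃ C, ∀ w, ‖w‖ ^ k *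
        ‖iteratedFDeriv ℝ n (fun w => ∫ v, g v • K (w, v) ∂μ) w‖ ≤ C := by
  have hderiv {V : Type} [NormedAddCommGroup V] [NormedSpace ℝ V] [NormedSpace ℂ V]
      [SMulCommClass ℝ ℂ V] (K : 𝓢(E × F, V)) (w : E) :
      HasFDerivAt (fun w => ∫ v, g v • K (w, v) ∂μ) (∫ v, g v • fderivFst K (w, v) ∂μ) w := by
    obtain ⟨C₀, -, h₀⟩ := K.exists_norm_pow_mul_one_add_norm_pow_mul_le 0 N
    obtain ⟨C₁, -, h₁⟩ := (fderivFst K).exists_norm_pow_mul_one_add_norm_pow_mul_le 0 N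
    simp only [pow_zero, one_mul] at h₀ h₁
    refine hasFDerivAt_integral_of_dominated_of_fderiv_le (s := Set.univ)
      (bound := fun v => C₁ * (((1 + ‖v‖) ^ N)⁻¹ * ‖g v‖)) Filter.univ_mem
      (Filter.Eventually.of_forall fun w' =>
        (integrable_smul_of_norm_le hg hgm (by fun_prop) (h₀ w')).aestronglyMeasurable)
      (integrable_smul_of_norm_le hg hgm (by fun_prop) (h₀ w))
      (integrable_smul_of_norm_le hg hgm (by fun_prop) (h₁ w)).aestronglyMeasurable
      (ae_of_all _ fun v w' _ => ?_) (hg.const_mul C₁)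
      (ae_of_all _ fun v w' _ => (hasFDerivAt_fderivFst K w' v).const_smul (g v))
    rw [norm_smul, mul_comm, ← mul_assoc]
    gcongr
    exact h₁ w' v
  induction n with
  | zero =>
    intro V _ _ _ _ K
    refine ⟨contDiff_zero.2 (continuous_iff_continuousAt.2 fun w => (hderiv K w).continuousAt),
      fun k => ?_⟩
    obtain ⟨C, hC, h⟩ := K.exists_norm_pow_mul_one_add_norm_pow_mul_le k N
    refine ⟨∫ v, C * (((1 + ‖v‖) ^ N)⁻¹ * ‖g v‖) ∂μ, fun w => ?_⟩
    rw [norm_iteratedFDeriv_zero]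
    calc ‖w‖ ^ k * ‖∫ v, g v • K (w, v) ∂μ‖
        ≤ ‖w‖ ^ k * ∫ v, ‖g v • K (w, v)‖ ∂μ := by
          gcongr; exact norm_integral_le_integral_norm _
      _ = ∫ v, ‖w‖ ^ k * ‖g v • K (w, v)‖ ∂μ := (integral_const_mul _ _).symm
      _ ≤ _ := by
          refine integral_mono_of_nonneg (ae_of_all _ fun v => by positivity) (hg.const_mul C)
            (ae_of_all _ fun v => ?_)
          have := mul_le_mul_of_nonneg_right (h w v) (norm_nonneg (g v))
          simp only [norm_smul]
          linarith
  | succ n ih =>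
    intro V _ _ _ _ K
    have hfd : fderiv ℝ (fun w => ∫ v, g v • K (w, v) ∂μ) =
        fun w => ∫ v, g v • fderivFst K (w, v) ∂μ := funext fun w => (hderiv K w).fderiv
    obtain ⟨h1, h2⟩ := ih (fderivFst K)
    constructor
    · push_cast
      rw [contDiff_succ_iff_fderiv, hfd]
      exact ⟨fun w => (hderiv K w).differentiableAt, by simp, h1⟩
    · intro k
      obtain ⟨C, hC⟩ := h2 k
      refine ⟨C, fun w => ?_⟩
      rw [← norm_iteratedFDeriv_fderiv, hfd]
      exact hC w

lemma integrable_inv_one_add_norm_pow_mul_norm [μ.IsAddHaarMeasure] {g : F → ℂ}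
    (hg : MemLp g 2 μ) :
    ∃ N : ℕ, Integrable (fun v => ((1 + ‖v‖) ^ N)⁻¹ * ‖g v‖) μ := by
  refine ⟨Module.finrank ℝ F + 1, ?_⟩
  have h : MemLp (fun v : F => ((1 + ‖v‖) ^ (Module.finrank ℝ F + 1))⁻¹) 2 μ := by
    have hc : Continuous fun v : F => ((1 + ‖v‖) ^ (Module.finrank ℝ F + 1))⁻¹ :=
      Continuous.inv₀ (by fun_prop) fun v => by positivity
    rw [memLp_two_iff_integrable_sq hc.aestronglyMeasurable]
    have hlt : (Module.finrank ℝ F : ℝ) < ((2 * (Module.finrank ℝ F + 1) : ℕ) : ℝ) := by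
      exact_mod_cast (by omega)
    refine (integrable_one_add_norm (μ := μ) hlt).congr (ae_of_all _ fun v => ?_)
    simp only
    rw [Real.rpow_neg (by positivity), Real.rpow_natCast, inv_pow, ← pow_mul, mul_comm 2]
  exact h.integrable_mul hg.norm

/-- An integral operator with Schwartz kernel maps `L²` into the Schwartz space. -/
lemma exists_schwartz_eq_integral_smul [μ.IsAddHaarMeasure] {g : F → ℂ} (hg : MemLp g 2 μ)
    (K : 𝓢(E × F, ℂ)) : ∃ φ : 𝓢(E, ℂ), ∀ w, φ w = ∫ v, g v • K (w, v) ∂μ := by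
  obtain ⟨N, hN⟩ := integrable_inv_one_add_norm_pow_mul_norm hg
  have h n := integral_smul_schwartz_decay (E := E) hN hg.1 n K
  exact ⟨⟨_, contDiff_infty.2 fun n => (h n).1, fun k n => (h n).2 k⟩, fun w => rfl⟩

end Kernel

/-! ### The heat kernel -/

section HeatKernel

variable {d : ℕ}

local notation "E" => EuclideanSpace ℝ (Fin d)

/-- The heat kernel as a Schwartz function. -/
noncomputable def heatKernelSchwartz (d : ℕ) (t : ℝ) (ht : 0 < t) :
    𝓢(EuclideanSpace ℝ (Fin d), ℂ) :=
  (((2 * Real.pi * t) ^ (-(d : ℝ) / 2) : ℝ) : ℂ) •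
    gaussianSchwartz (EuclideanSpace ℝ (Fin d)) (1 / (2 * t)) (by positivity)

@[simp] lemma heatKernelSchwartz_apply (t : ℝ) (ht : 0 < t) (x : E) :
    heatKernelSchwartz d t ht x = (heatKernel d t x : ℂ) := by
  simp only [heatKernelSchwartz, smul_apply, gaussianSchwartz_apply, smul_eq_mul,
    heatKernel, Complex.ofReal_mul]
  congr 3
  ring

lemma memLp_heatKernel {t : ℝ} (ht : 0 < t) (p : ENNReal) :
    MemLp (fun x : E => (heatKernel d t x : ℂ)) p := by
  exact ((heatKernelSchwartz d t ht).memLp p).ae_eq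
    (ae_of_all _ (heatKernelSchwartz_apply t ht))

lemma memLp_heatKernel_sub {t : ℝ} (ht : 0 < t) (p : ENNReal) (x : E) :
    MemLp (fun y : E => (heatKernel d t (x - y) : ℂ)) p :=
  (memLp_heatKernel ht p).comp_measurePreserving (Measure.measurePreserving_sub_left volume x)

/-- The exponents agree by completing the square: `y` is the weighted mean of `y - αz` and
`y + βz`, where `α = t/(s+t)` and `β = s/(s+t)`, and `z` is their difference. -/
lemma heatKernel_mul_heatKernel {s t r : ℝ} (hs : 0 < s) (ht : 0 < t) (hr : 1 / r = 1 / s + 1 / t)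
    (y z : E) :
    heatKernel d t (y - (t / (s + t)) • z) * heatKernel d s (y + (s / (s + t)) • z) =
      heatKernel d r y * heatKernel d (s + t) z := by
  have hr0 : r = s * t / (s + t) := by
    rw [← one_div_one_div r, hr]
    field_simp
    ring
  subst hr0
  have hpi := Real.pi_pos
  simp only [heatKernel]
  have hmul (a b p q : ℝ) :
      a * Real.exp p * (b * Real.exp q) = a * b * Real.exp (p + q) := by
    rw [Real.exp_add]; ring
  rw [hmul, hmul, ← Real.mul_rpow (by positivity) (by positivity),
    ← Real.mul_rpow (by positivity) (by positivity), norm_sub_sq_real, norm_add_sq_real]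
  simp only [inner_smul_right, norm_smul, Real.norm_eq_abs, mul_pow, sq_abs]
  congr 2
  · field_simp
  · field_simp
    ring

lemma heatKernel_pos {t : ℝ} (ht : 0 < t) (x : E) : 0 < heatKernel d t x := by
  unfold heatKernel
  positivity

/-! ### The product as a heat evolution -/

lemma measurePreserving_shear {V : Type*} [NormedAddCommGroup V] [NormedSpace ℝ V]
    [FiniteDimensional ℝ V] [MeasurableSpace V] [BorelSpace V] (μ : Measure V)
    [μ.IsAddHaarMeasure] (c : ℝ) :
    MeasurePreserving (fun p : V × V => (p.1 + c • p.2, p.2)) (μ.prod μ) (μ.prod μ) := by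
  have h : MeasurePreserving (fun p : V × V => (p.1, p.2 + c • p.1)) (μ.prod μ) (μ.prod μ) :=
    MeasurePreserving.skew_product (g := fun z w => w + c • z) (MeasurePreserving.id μ)
      (by fun_prop) (ae_of_all _ fun z => (measurePreserving_add_right μ (c • z)).map_eq)
  exact Measure.measurePreserving_swap.comp (h.comp Measure.measurePreserving_swap)

/-- The map `(w, z) ↦ (w + αz, w - βz)` preserves Lebesgue measure when `α + β = 1`. -/
lemma measurePreserving_mean_difference {V : Type*} [NormedAddCommGroup V] [NormedSpace ℝ V]
    [FiniteDimensional ℝ V] [MeasurableSpace V] [BorelSpace V] (μ : Measure V)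
    [μ.IsAddHaarMeasure] {α β : ℝ} (h : α + β = 1) :
    MeasurePreserving (fun p : V × V => (p.1 + α • p.2, p.1 - β • p.2)) (μ.prod μ) (μ.prod μ) := by
  convert (measurePreserving_shear μ 1).comp
    (Measure.measurePreserving_swap.comp (measurePreserving_shear μ (-β))) using 1
  ext p : 1
  obtain rfl : α = 1 - β := by linarith
  simp only [Function.comp, Prod.swap, Prod.mk.injEq]
  exact ⟨by module, by module⟩

/-- The function `w ↦ ∫ ρ_{s+t}(z) f₁(w + tz/(s+t)) f₂(w - sz/(s+t)) dz`, whose image under the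
time-`r` heat operator is the product of `e^{tΔ/2} f₁` and `e^{sΔ/2} f₂`. -/
noncomputable def heatProduct (s t : ℝ) (f₁ f₂ : E → ℂ) (w : E) : ℂ :=
  ∫ z : E, (heatKernel d (s + t) z : ℂ) *
    (f₁ (w + (t / (s + t)) • z) * f₂ (w - (s / (s + t)) • z))

lemma norm_integral_mul_sq_le {X : Type*} [MeasurableSpace X] {μ : Measure X} {f g : X → ℂ}
    (hf : MemLp f 2 μ) (hg : MemLp g 2 μ) :
    ‖∫ x, f x * g x ∂μ‖ ^ 2 ≤ (∫ x, ‖f x‖ ^ 2 ∂μ) * ∫ x, ‖g x‖ ^ 2 ∂μ := by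
  have h := integral_mul_norm_le_Lp_mul_Lq (μ := μ) (f := f) (g := g) (p := 2) (q := 2)
    (by rw [Real.holderConjugate_iff]; norm_num) (by simpa using hf) (by simpa using hg)
  have h2 : ‖∫ x, f x * g x ∂μ‖ ≤ _ := (norm_integral_le_integral_norm _).trans
    ((le_of_eq (by simp only [norm_mul])).trans h)
  have hA : 0 ≤ ∫ x, ‖f x‖ ^ 2 ∂μ := integral_nonneg fun _ => by positivity
  have hB : 0 ≤ ∫ x, ‖g x‖ ^ 2 ∂μ := integral_nonneg fun _ => by positivity
  simp only [Real.rpow_two, ← Real.sqrt_eq_rpow] at h2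
  calc _ ≤ _ := pow_le_pow_left₀ (norm_nonneg _) h2 2
    _ = _ := by rw [mul_pow, Real.sq_sqrt hA, Real.sq_sqrt hB]

lemma memLp_two_comp_mean_difference {f₁ f₂ : E → ℂ} (h₁ : MemLp f₁ 2) (h₂ : MemLp f₂ 2)
    {α β : ℝ} (h : α + β = 1) :
    MemLp (fun p : E × E => f₁ (p.1 + α • p.2) * f₂ (p.1 - β • p.2)) 2 (volume.prod volume) := by
  have hm : AEStronglyMeasurable (fun p : E × E => f₁ p.1 * f₂ p.2) (volume.prod volume) :=
    h₁.1.comp_fst.mul h₂.1.comp_snd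
  have : MemLp (fun p : E × E => f₁ p.1 * f₂ p.2) 2 (volume.prod volume) := by
    rw [memLp_two_iff_integrable_sq_norm hm]
    simp only [norm_mul, mul_pow]
    exact ((memLp_two_iff_integrable_sq_norm h₁.1).1 h₁).mul_prod
      ((memLp_two_iff_integrable_sq_norm h₂.1).1 h₂)
  exact this.comp_measurePreserving (measurePreserving_mean_difference volume h)

/-- By Cauchy–Schwarz in `z`, `|heatProduct|²` is at most `‖ρ_{s+t}‖²` times
`∫ |f₁(w + αz)|² |f₂(w - βz)|² dz`, whose integral over `w` is `‖f₁‖² ‖f₂‖²`. -/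
lemma memLp_heatProduct {s t : ℝ} (hs : 0 < s) (ht : 0 < t) {f₁ f₂ : E → ℂ}
    (h₁ : MemLp f₁ 2) (h₂ : MemLp f₂ 2) : MemLp (heatProduct s t f₁ f₂) 2 := by
  have hst : t / (s + t) + s / (s + t) = 1 := by field_simp; ring
  have hG := memLp_two_comp_mean_difference h₁ h₂ hst
  have hρ := memLp_heatKernel (d := d) (add_pos hs ht) 2
  have hm : AEStronglyMeasurable (heatProduct s t f₁ f₂) volume :=
    (hρ.1.comp_snd.mul hG.1).integral_prod_right'
  rw [memLp_two_iff_integrable_sq_norm hm]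
  have hG2 := (memLp_two_iff_integrable_sq_norm hG.1).1 hG
  refine (hG2.integral_prod_left.const_mul (∫ z : E, ‖(heatKernel d (s + t) z : ℂ)‖ ^ 2)).mono'
    (hm.norm.pow 2) ?_
  filter_upwards [hG2.prod_right_ae, hG.1.prodMk_left] with w hw hwm
  rw [Real.norm_of_nonneg (by positivity)]
  exact norm_integral_mul_sq_le hρ ((memLp_two_iff_integrable_sq_norm hwm).2 hw)

lemma integrable_heatKernel_sub_mul {t : ℝ} (ht : 0 < t) {f : E → ℂ} (hf : MemLp f 2) (x : E) :
    Integrable (fun y : E => (heatKernel d t (x - y) : ℂ) * f y) :=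
  (memLp_heatKernel_sub ht 2 x).integrable_mul hf

theorem heatOperator_mul_heatOperator {s t r : ℝ} (hs : 0 < s) (ht : 0 < t)
    (hr : 1 / r = 1 / s + 1 / t) {f₁ f₂ : E → ℂ} (h₁ : MemLp f₁ 2) (h₂ : MemLp f₂ 2) (x : E) :
    heatOperator t f₁ x * heatOperator s f₂ x = heatOperator r (heatProduct s t f₁ f₂) x := by
  have hst : t / (s + t) + s / (s + t) = 1 := by field_simp; ring
  have hΦ := measurePreserving_mean_difference (volume : Measure E) hst
  have hH := (integrable_heatKernel_sub_mul ht h₁ x).mul_prod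
    (integrable_heatKernel_sub_mul hs h₂ x)
  have hHΦ := hΦ.integrable_comp_of_integrable hH
  have hker (p : E × E) :
      (heatKernel d t (x - (p.1 + (t / (s + t)) • p.2)) : ℂ) * f₁ (p.1 + (t / (s + t)) • p.2) *
        ((heatKernel d s (x - (p.1 - (s / (s + t)) • p.2)) : ℂ) *
          f₂ (p.1 - (s / (s + t)) • p.2)) =
      (heatKernel d r (x - p.1) : ℂ) * ((heatKernel d (s + t) p.2 : ℂ) *
        (f₁ (p.1 + (t / (s + t)) • p.2) * f₂ (p.1 - (s / (s + t)) • p.2))) := by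
    have h := heatKernel_mul_heatKernel hs ht hr (x - p.1) p.2
    rw [sub_sub, sub_add] at h
    rw [mul_mul_mul_comm, ← Complex.ofReal_mul, h, Complex.ofReal_mul]
    ring
  simp only [heatOperator]
  rw [← integral_prod_mul, ← hΦ.map_eq, integral_map hΦ.measurable.aemeasurable
    (by rw [hΦ.map_eq]; exact hH.aestronglyMeasurable)]
  simp only [Function.comp_def, hker] at hHΦ ⊢
  rw [integral_prod _ hHΦ]
  simp only [integral_const_mul, heatProduct]

/-! ### Preservation of the Schwartz class -/

/-- The linear change of variables `(w, v) ↦ (z, u)` with `w = u - αz` and `v = w - βz`,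
for `α + β = 1`. -/
noncomputable def meanDifferenceEquiv (V : Type*) [NormedAddCommGroup V] [NormedSpace ℝ V]
    (α β : ℝ) (hβ : β ≠ 0) (h : α + β = 1) : (V × V) ≃L[ℝ] (V × V) :=
  ContinuousLinearEquiv.equivOfInverse
    ((β⁻¹ • (ContinuousLinearMap.fst ℝ V V - ContinuousLinearMap.snd ℝ V V)).prod
      (ContinuousLinearMap.fst ℝ V V +
        α • (β⁻¹ • (ContinuousLinearMap.fst ℝ V V - ContinuousLinearMap.snd ℝ V V))))
    ((ContinuousLinearMap.snd ℝ V V - α • ContinuousLinearMap.fst ℝ V V).prod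
      (ContinuousLinearMap.snd ℝ V V - ContinuousLinearMap.fst ℝ V V))
    (fun p => by
      obtain rfl : α = 1 - β := by linarith
      have : β * β⁻¹ = 1 := mul_inv_cancel₀ hβ
      ext1
      · simp
      · simp only [ContinuousLinearMap.prod_apply, sub_apply,
          add_apply, smul_apply,
          ContinuousLinearMap.coe_fst', ContinuousLinearMap.coe_snd']
        match_scalars
        · linear_combination -this
        · linear_combination this)
    (fun p => by
      obtain rfl : α = 1 - β := by linarith
      have : β⁻¹ * β = 1 := inv_mul_cancel₀ hβ
      ext1
      · simp only [ContinuousLinearMap.prod_apply, sub_apply,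
          add_apply, smul_apply,
          ContinuousLinearMap.coe_fst', ContinuousLinearMap.coe_snd']
        match_scalars
        · ring
        · linear_combination this
      · simp only [ContinuousLinearMap.prod_apply, sub_apply,
          add_apply, smul_apply,
          ContinuousLinearMap.coe_fst', ContinuousLinearMap.coe_snd']
        match_scalars
        · ring
        · linear_combination (1 - β) * this)

@[simp] lemma meanDifferenceEquiv_apply {V : Type*} [NormedAddCommGroup V] [NormedSpace ℝ V]
    (α β : ℝ) (hβ : β ≠ 0) (h : α + β = 1) (p : V × V) :
    meanDifferenceEquiv V α β hβ h p =
      (β⁻¹ • (p.1 - p.2), p.1 + α • (β⁻¹ • (p.1 - p.2))) := rfl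

/-- Substituting `v = w - sz/(s+t)` turns `heatProduct` into an integral operator applied to `f₂`,
whose kernel is Schwartz when `f₁` is. -/
lemma exists_schwartz_eq_heatProduct {s t : ℝ} (hs : 0 < s) (ht : 0 < t) (φ : 𝓢(E, ℂ))
    {f₂ : E → ℂ} (h₂ : MemLp f₂ 2) :
    ∃ ψ : 𝓢(E, ℂ), ∀ w, heatProduct s t φ f₂ w = ψ w := by
  have hst : t / (s + t) + s / (s + t) = 1 := by field_simp; ring
  set β := s / (s + t) with hβdef
  set α := t / (s + t) with hαdef
  have hβ : β ≠ 0 := by positivity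
  obtain ⟨ψ, hψ⟩ := exists_schwartz_eq_integral_smul h₂
    (SchwartzMap.compCLMOfContinuousLinearEquiv ℝ (meanDifferenceEquiv E α β hβ hst)
      (schwartzTensor (heatKernelSchwartz d (s + t) (add_pos hs ht)) φ))
  refine ⟨(|((-β) ^ Module.finrank ℝ E)⁻¹| : ℝ) • ψ, fun w => ?_⟩
  rw [smul_apply, hψ]
  have h := Measure.integral_comp_smul (volume : Measure E) (fun v : E =>
    f₂ (w + v) * ((heatKernel d (s + t) (β⁻¹ • (-v)) : ℂ) * φ (w + α • β⁻¹ • (-v)))) (-β)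
  have h' := integral_add_left_eq_self (μ := (volume : Measure E)) (fun v : E =>
    f₂ v * ((heatKernel d (s + t) (β⁻¹ • (w - v)) : ℂ) * φ (w + α • β⁻¹ • (w - v)))) w
  simp only [sub_add_cancel_left] at h'
  rw [h'] at h
  simp only [SchwartzMap.compCLMOfContinuousLinearEquiv_apply, Function.comp,
    meanDifferenceEquiv_apply, schwartzTensor_apply, heatKernelSchwartz_apply, smul_eq_mul] at h ⊢
  rw [← h, heatProduct]
  refine integral_congr_ae (ae_of_all _ fun z => ?_)
  simp only [neg_smul, neg_neg, smul_smul, inv_mul_cancel₀ hβ, one_smul, ← sub_eq_add_neg]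
  ring

end HeatKernel

/-! ### Injectivity of the heat operator -/

section Injective

open scoped FourierTransform RealInnerProductSpace

/-- The Fourier transform is injective on `L¹`: pair with a Schwartz function, move the Fourier
transform across, and use that it maps the Schwartz space onto itself. -/
lemma ae_eq_zero_of_fourier_eq_zero {V : Type} [NormedAddCommGroup V] [InnerProductSpace ℝ V]
    [FiniteDimensional ℝ V] [MeasurableSpace V] [BorelSpace V] {k : V → ℂ} (hk : Integrable k)
    (h : ∀ ξ, 𝓕 k ξ = 0) : k =ᵐ[volume] 0 := by
  have hS (χ : 𝓢(V, ℂ)) : ∫ v, χ v * k v = 0 := by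
    obtain ⟨ψ, rfl⟩ : ∃ ψ : 𝓢(V, ℂ), 𝓕 ψ = χ := ⟨𝓕⁻ χ, FourierTransform.fourier_fourierInv_eq χ⟩
    have := VectorFourier.integral_fourierIntegral_smul_eq_flip (L := innerₗ V) (μ := volume)
      (ν := volume) (e := Real.fourierChar) Real.continuous_fourierChar
      (by exact continuous_inner) ψ.integrable hk
    simp only [flip_innerₗ, smul_eq_mul] at this
    rw [SchwartzMap.fourier_coe]
    refine Eq.trans this ?_
    refine (integral_congr_ae (ae_of_all _ fun ξ => ?_)).trans (integral_zero V ℂ)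
    have := h ξ
    simp only [Real.fourier_eq, VectorFourier.fourierIntegral, innerₗ_apply_apply] at this ⊢
    rw [this, mul_zero]
  refine ae_eq_zero_of_integral_contDiff_smul_eq_zero hk.locallyIntegrable fun g hg hgc => ?_
  have hg₁ : HasCompactSupport (Complex.ofRealCLM ∘ g) := hgc.comp_left rfl
  have hg₂ : ContDiff ℝ ∞ (Complex.ofRealCLM ∘ g) := by fun_prop
  simpa using hS (hg₁.toSchwartzMap hg₂)

variable {d : ℕ}

local notation "E" => EuclideanSpace ℝ (Fin d)

lemma fourier_heatKernel_ne_zero {t : ℝ} (ht : 0 < t) (ξ : E) :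
    𝓕 (fun x : E => (heatKernel d t x : ℂ)) ξ ≠ 0 := by
  have hb : 0 < ((1 / (2 * t) : ℝ) : ℂ).re := by rw [Complex.ofReal_re]; positivity
  have h1 : (fun x : E => (heatKernel d t x : ℂ)) =
      (((2 * Real.pi * t) ^ (-(d : ℝ) / 2) : ℝ) : ℂ) •
        fun x : E => Complex.exp (-((1 / (2 * t) : ℝ) : ℂ) * ‖x‖ ^ 2) := by
    ext x
    simp only [heatKernel, Complex.ofReal_mul, Complex.ofReal_exp, Pi.smul_apply, smul_eq_mul]
    congr 2
    push_cast
    ring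
  rw [h1, Real.fourier_eq]
  simp only [Pi.smul_apply, smul_comm _ (((2 * Real.pi * t) ^ (-(d : ℝ) / 2) : ℝ) : ℂ)]
  rw [integral_smul, ← Real.fourier_eq, fourier_gaussian_innerProductSpace hb]
  have hpos : 0 < (2 * Real.pi * t) ^ (-(d : ℝ) / 2) := by positivity
  refine smul_ne_zero (by exact_mod_cast hpos.ne') (mul_ne_zero ?_ (Complex.exp_ne_zero _))
  rw [Complex.cpow_def_of_ne_zero]
  · exact Complex.exp_ne_zero _
  · refine div_ne_zero (by exact_mod_cast Real.pi_ne_zero) ?_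
    intro h
    rw [h] at hb
    simp at hb

/-- Since `ρ_r(x - y) ρ_r(x) = ρ_{r/2}(x - y/2) ρ_{2r}(y)`, the Fourier transform of
`ρ_r * e^{rΔ/2} h` at `ξ` factors as a Gaussian times the Fourier transform of the integrable
function `ρ_{2r} h` at `ξ/2`. -/
theorem ae_eq_zero_of_heatOperator_ae_eq_zero {r : ℝ} (hr : 0 < r) {h : E → ℂ} (hh : MemLp h 2)
    (h0 : ∀ᵐ x, heatOperator r h x = 0) : h =ᵐ[volume] 0 := by
  have hk : Integrable (fun y : E => (heatKernel d (r + r) y : ℂ) * h y) :=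
    (memLp_heatKernel (add_pos hr hr) 2).integrable_mul hh
  have hm : Integrable (fun x : E => (heatKernel d (r / 2) x : ℂ)) :=
    memLp_one_iff_integrable.1 (memLp_heatKernel (by positivity) 1)
  have hrr : 1 / (r / 2) = 1 / r + 1 / r := by field_simp; norm_num
  set c := r / (r + r) with hc
  have hc0 : c ≠ 0 := by positivity
  have key (ξ : E) : 𝓕 (fun y : E => (heatKernel d (r + r) y : ℂ) * h y) (c • ξ) = 0 := by
    have hG := ((Real.fourierIntegral_convergent_iff ξ).2 hm).mul_prod
      ((Real.fourierIntegral_convergent_iff (c • ξ)).2 hk)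
    have hS := measurePreserving_shear (volume : Measure E) (-c)
    have hGS := hS.integrable_comp_of_integrable hG
    have hpt (p : E × E) :
        (Real.fourierChar (-⟪p.1 + -c • p.2, ξ⟫) • (heatKernel d (r / 2) (p.1 + -c • p.2) : ℂ)) *
          (Real.fourierChar (-⟪p.2, c • ξ⟫) • ((heatKernel d (r + r) p.2 : ℂ) * h p.2)) =
        (Real.fourierChar (-⟪p.1, ξ⟫) • (heatKernel d r p.1 : ℂ)) *
          ((heatKernel d r (p.1 - p.2) : ℂ) * h p.2) := by
      have e1 : (Real.fourierChar (-⟪p.1, ξ⟫) : ℂ) =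
          Real.fourierChar (-⟪p.1 + -c • p.2, ξ⟫) * Real.fourierChar (-⟪p.2, c • ξ⟫) := by
        rw [← Circle.coe_mul, ← AddChar.map_add_eq_mul, inner_add_left, inner_smul_left,
          inner_smul_right]
        congr 2
        simp
      have e2 : (heatKernel d r (p.1 - p.2) : ℂ) * heatKernel d r p.1 =
          heatKernel d (r / 2) (p.1 + -c • p.2) * heatKernel d (r + r) p.2 := by
        have := heatKernel_mul_heatKernel hr hr hrr (p.1 + -c • p.2) p.2
        rw [← hc] at this
        have hc2 : c = 1 / 2 := by rw [hc]; field_simp; norm_num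
        rw [← Complex.ofReal_mul, ← Complex.ofReal_mul, ← this]
        congr 3
        · rw [hc2]; module
        · module
      simp only [Circle.smul_def, smul_eq_mul, e1]
      linear_combination -(Real.fourierChar (-⟪p.1 + -c • p.2, ξ⟫) : ℂ) *
        Real.fourierChar (-⟪p.2, c • ξ⟫) * h p.2 * e2
    have hprod : 𝓕 (fun x : E => (heatKernel d (r / 2) x : ℂ)) ξ *
        𝓕 (fun y : E => (heatKernel d (r + r) y : ℂ) * h y) (c • ξ) = 0 := by
      rw [Real.fourier_eq, Real.fourier_eq, ← integral_prod_mul, ← hS.map_eq,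
        integral_map hS.measurable.aemeasurable (by rw [hS.map_eq]; exact hG.aestronglyMeasurable)]
      simp only [Function.comp_def, hpt] at hGS ⊢
      rw [integral_prod _ hGS]
      simp only [integral_const_mul]
      refine integral_eq_zero_of_ae ?_
      filter_upwards [h0] with x hx
      rw [heatOperator] at hx
      simp [hx]
    exact (mul_eq_zero.1 hprod).resolve_left (fourier_heatKernel_ne_zero (by positivity) ξ)
  have hz := ae_eq_zero_of_fourier_eq_zero hk fun ξ => by
    simpa [smul_smul, mul_inv_cancel₀ hc0] using key (c⁻¹ • ξ)
  filter_upwards [hz] with y hy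
  have hy' : (heatKernel d (r + r) y : ℂ) * h y = 0 := hy
  exact (mul_eq_zero.1 hy').resolve_left
    (by exact_mod_cast (heatKernel_pos (add_pos hr hr) y).ne')

theorem eq_of_heatOperator_ae_eq {r : ℝ} (hr : 0 < r) (f g : Lp ℂ 2 (volume : Measure E))
    (h : ∀ᵐ x, heatOperator r f x = heatOperator r g x) : f = g := by
  have hz := ae_eq_zero_of_heatOperator_ae_eq_zero hr ((Lp.memLp f).sub (Lp.memLp g)) (by
    filter_upwards [h] with x hx
    have hsub := integral_sub (integrable_heatKernel_sub_mul hr (Lp.memLp f) x)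
      (integrable_heatKernel_sub_mul hr (Lp.memLp g) x)
    simp only [heatOperator, Pi.sub_apply, mul_sub] at hx hsub ⊢
    rw [hsub, hx, sub_self])
  ext1
  filter_upwards [hz] with x hx
  simpa [sub_eq_zero] using hx

end Injective

/-! ### Products of heat evolutions -/

lemma heatOperator_congr_ae {d : ℕ} (t : ℝ) {f g : EuclideanSpace ℝ (Fin d) → ℂ}
    (h : f =ᵐ[volume] g) : heatOperator t f = heatOperator t g := by
  ext x
  refine integral_congr_ae ?_
  filter_upwards [h] with y hy
  rw [hy]

lemma exists_heatOperator_mul_eq {d : ℕ} {s t r : ℝ} (hs : 0 < s) (ht : 0 < t)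
    (hr : 1 / r = 1 / s + 1 / t) (f₁ f₂ : Lp ℂ 2 (volume : Measure (EuclideanSpace ℝ (Fin d)))) :
    ∃ f : Lp ℂ 2 (volume : Measure (EuclideanSpace ℝ (Fin d))),
      (∀ x, heatOperator t f₁ x * heatOperator s f₂ x = heatOperator r f x) ∧
      (IsSchwartzClass f₁ → IsSchwartzClass f) := by
  by_cases h : IsSchwartzClass f₁
  · obtain ⟨φ, hφ⟩ := h
    obtain ⟨ψ, hψ⟩ := exists_schwartz_eq_heatProduct hs ht φ (Lp.memLp f₂)
    refine ⟨ψ.toLp 2 volume, fun x => ?_, fun _ => ⟨ψ, ψ.coeFn_toLp 2 volume⟩⟩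
    rw [heatOperator_congr_ae t hφ, heatOperator_congr_ae r (ψ.coeFn_toLp 2 volume), ← funext hψ]
    exact heatOperator_mul_heatOperator hs ht hr (φ.memLp 2) (Lp.memLp f₂) x
  · have hf := memLp_heatProduct hs ht (Lp.memLp f₁) (Lp.memLp f₂)
    refine ⟨hf.toLp _, fun x => ?_, fun h' => absurd h' h⟩
    rw [heatOperator_congr_ae r hf.coeFn_toLp]
    exact heatOperator_mul_heatOperator hs ht hr (Lp.memLp f₁) (Lp.memLp f₂) x

theorem theorem2p7 (d : ℕ) (s t r : ℝ) (hs : 0 < s) (ht : 0 < t) (hr : 1 / r = 1 / s + 1 / t)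
    (f₁ f₂ : Lp ℂ 2 (volume : Measure (EuclideanSpace ℝ (Fin d)))) :
    ∃ f : Lp ℂ 2 (volume : Measure (EuclideanSpace ℝ (Fin d))),
      (∀ x, heatOperator t f₁ x * heatOperator s f₂ x = heatOperator r f x) ∧
      (∀ g : Lp ℂ 2 (volume : Measure (EuclideanSpace ℝ (Fin d))),
        (∀ᵐ x, heatOperator t f₁ x * heatOperator s f₂ x = heatOperator r g x) → g = f) ∧
      (IsSchwartzClass f₁ ∨ IsSchwartzClass f₂ → IsSchwartzClass f) := by
  have hr0 : 0 < r := by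
    rw [← one_div_pos, hr]
    positivity
  obtain ⟨f, hf, hfS⟩ := exists_heatOperator_mul_eq hs ht hr f₁ f₂
  obtain ⟨f', hf', hfS'⟩ := exists_heatOperator_mul_eq ht hs (hr.trans (add_comm _ _)) f₂ f₁
  have huniq (g : Lp ℂ 2 (volume : Measure (EuclideanSpace ℝ (Fin d))))
      (hg : ∀ᵐ x, heatOperator t f₁ x * heatOperator s f₂ x = heatOperator r g x) : g = f :=
    eq_of_heatOperator_ae_eq hr0 g f (hg.mono fun x hx => hx.symm.trans (hf x))
  -- The roles of `f₁` and `f₂` are exchanged in `f'`, which uniqueness identifies with `f`.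
  have hff' : f' = f := huniq f' (ae_of_all _ fun x => (mul_comm _ _).trans (hf' x))
  exact ⟨f, hf, huniq, Or.rec hfS fun h => hff' ▸ hfS' h⟩
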